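/- Let $(p_k)_{k\ge 2}$ satisfy $p_k\in[0,1)$, $\sum_{k\ge 2}p_k=1$, $\sum_{k=2}^{n}p_k<1$ for every $n\in\mathbb N$, and $a:=\sum_{k\ge 2}k\,p_k<\infty$, and put $\hat p_k:=k p_k/a$. Let $s\ge 2$ be an integer. The random rooted tree $\mathbf{GW}(s,p)$ is the genealogical tree of the following two-type branching process, in which all individuals reproduce independently. The process starts with one distinguished individual, the root. An ordinary individual has $m$ children with probability $p_{m+1}$, all of them ordinary. A distinguished individual other than the root has $m$ children with probability $\hat p_{m+1}$; if $m\le s$ all of them are distinguished, and if $m>s$ then $s$ of them are distinguished and the other $m-s$ are ordinary. The types of the children of the root are assigned in the same way, and the number of children of the root equals $m$ either with probability $\hat p_m$ for every $m$, or with probability $\hat p_{m+1}$ for every $m$ (the statement holds for each of these two conventions). Let $\alpha\in(0,1)$ be such that $$b_\alpha:=\sum_{k\ge s+1}(k-s)^\alpha\,\hat p_k<\infty ,$$ and put $\gamma:=1/\alpha$, $q(K):=e^{4K}-1$, $$K_c:=\tfrac14\ln\frac{a}{a-1},\qquad \widehat K_c:=\tfrac14\ln\frac{s^\gamma+1}{s^\gamma}.$$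 Let $\theta\in(0,1)$ satisfy $\theta<\min\{q(K_c),\,q(\widehat K_c)\}$, and consider Bernoulli bond percolation on $\mathbf{GW}(s,p)$, in which, given the tree, each edge is open with probability $\theta$, independently of the others. Then with probability one there is no giant component: for almost every realization of the tree, almost surely every connected component of the graph of open edges is finite. -/

import Mathlib

open MeasureTheory ProbabilityTheory
open scoped ENNReal

noncomputable section

namespace GWPercolation

/-- A sequence `p = (p_k)_{k ≥ 2}` (extended by `p_0 = p_1 = 0`) with `p_k ∈ [0,1)`,
`∑_{k ≥ 2} p_k = 1`, `∑_{k=2}^n p_k < 1` for every `n`, and `∑_{k ≥ 2} k p_k < ∞`. -/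
structure DegreeLaw where
  mass : ℕ → ℝ
  mass_zero : mass 0 = 0
  mass_one : mass 1 = 0
  mass_mem : ∀ k, mass k ∈ Set.Ico (0 : ℝ) 1
  hasSum_mass : HasSum mass 1
  partial_lt_one : ∀ n : ℕ, ∑ k ∈ Finset.Icc 2 n, mass k < 1
  summable_mean : Summable fun k : ℕ => (k : ℝ) * mass k

namespace DegreeLaw

variable (p : DegreeLaw)

/-- The mean `a = ∑_k k p_k`. -/
def mean : ℝ := ∑' k : ℕ, (k : ℝ) * p.mass k

/-- The size-biased sequence `p̂_k = k p_k / a`. -/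
def hat (k : ℕ) : ℝ := (k : ℝ) * p.mass k / p.mean

/-- `b_α = ∑_{k ≥ s+1} (k - s)^α p̂_k`, as an element of `[0, ∞]`. -/
def bAlpha (s : ℕ) (α : ℝ) : ℝ≥0∞ :=
  ∑' k : ℕ, if s + 1 ≤ k then ENNReal.ofReal (((k : ℝ) - (s : ℝ)) ^ α * p.hat k) else 0

theorem term_nonneg (k : ℕ) : 0 ≤ (k : ℝ) * p.mass k :=
  mul_nonneg (Nat.cast_nonneg k) (p.mass_mem k).1

theorem one_le_mean : 1 ≤ p.mean := by
  rw [mean, ← p.hasSum_mass.tsum_eq]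
  refine p.hasSum_mass.summable.tsum_le_tsum (fun k => ?_) p.summable_mean
  rcases Nat.eq_zero_or_pos k with rfl | hk
  · simp [p.mass_zero]
  · have h1 : (1 : ℝ) ≤ k := by exact_mod_cast hk
    nlinarith [(p.mass_mem k).1]

theorem hat_nonneg (k : ℕ) : 0 ≤ p.hat k :=
  div_nonneg (p.term_nonneg k) (by linarith [p.one_le_mean])

theorem hasSum_hat : HasSum p.hat 1 := by
  have h := p.summable_mean.hasSum.div_const p.mean
  have h2 : (∑' k : ℕ, (k : ℝ) * p.mass k) / p.mean = 1 :=
    div_self (by linarith [p.one_le_mean] : p.mean ≠ 0)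
  rw [h2] at h
  exact h

theorem hat_zero : p.hat 0 = 0 := by simp [hat]

end DegreeLaw

theorem hasSum_ofReal_one {w : ℕ → ℝ} (h0 : ∀ m, 0 ≤ w m) (h : HasSum w 1) :
    HasSum (fun m => ENNReal.ofReal (w m)) 1 := by
  have h2 := ENNReal.ofReal_tsum_of_nonneg h0 h.summable
  rw [h.tsum_eq, ENNReal.ofReal_one] at h2
  rw [h2]
  exact ENNReal.summable.hasSum

theorem hasSum_shift {w : ℕ → ℝ} (hz : w 0 = 0) (h : HasSum w 1) :
    HasSum (fun m => w (m + 1)) 1 := by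
  rw [hasSum_nat_add_iff 1]
  simpa [hz] using h

/-- The offspring law of an ordinary individual: `m` children with probability `p_{m+1}`. -/
def ordinaryLaw (p : DegreeLaw) : PMF ℕ :=
  ⟨fun m => ENNReal.ofReal (p.mass (m + 1)),
    hasSum_ofReal_one (fun m => (p.mass_mem (m + 1)).1) (hasSum_shift p.mass_zero p.hasSum_mass)⟩

/-- The offspring law of a distinguished individual other than the root:
`m` children with probability `p̂_{m+1}`. -/
def distinguishedLaw (p : DegreeLaw) : PMF ℕ :=
  ⟨fun m => ENNReal.ofReal (p.hat (m + 1)),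
    hasSum_ofReal_one (fun m => p.hat_nonneg (m + 1)) (hasSum_shift p.hat_zero p.hasSum_hat)⟩

/-- The two conventions for the number of children of the root. -/
inductive RootRule
  | degree
  | offspring

/-- The offspring law of the root: `m` children with probability `p̂_m` (rule `degree`: the degree
of the root has law `p̂`, as for all other distinguished vertices) or with probability `p̂_{m+1}`
(rule `offspring`: the root reproduces as all other distinguished vertices do). -/
def rootLaw (p : DegreeLaw) : RootRule → PMF ℕ
  | .degree => ⟨fun m => ENNReal.ofReal (p.hat m), hasSum_ofReal_one p.hat_nonneg p.hasSum_hat⟩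
  | .offspring => distinguishedLaw p

/-- The two types of individuals. -/
inductive Kind
  | distinguished
  | ordinary

/-- Individuals are labelled by finite words: `[]` is the root and `i :: v` is the child number `i`
(counted from `0`) of `v`. The root is distinguished, the first `s` children of a distinguished
individual are distinguished, and all other individuals are ordinary. -/
def kind (s : ℕ) : List ℕ → Kind
  | [] => .distinguished
  | i :: v =>
    match kind s v with
    | .distinguished => if i < s then .distinguished else .ordinary
    | .ordinary => .ordinary

/-- The law of the number of children of the individual with the given label. -/
def offspringLaw (p : DegreeLaw) (s : ℕ) (r : RootRule) : List ℕ → PMF ℕ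
  | [] => rootLaw p r
  | i :: v =>
    match kind s (i :: v) with
    | .distinguished => distinguishedLaw p
    | .ordinary => ordinaryLaw p

/-- The law of the family of offspring numbers, which are independent. -/
def gwMeasure (p : DegreeLaw) (s : ℕ) (r : RootRule) : Measure (List ℕ → ℕ) :=
  Measure.infinitePi fun v => (offspringLaw p s r v).toMeasure

/-- The labels of the individuals that are born when `v` has `N v` children. -/
def Born (N : List ℕ → ℕ) : List ℕ → Prop
  | [] => True
  | i :: v => Born N v ∧ i < N v

/-- The genealogical tree: its vertices are the individuals that are born, and its edges
join each individual to its children. With `N` drawn from `gwMeasure p s r`,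
this is the random tree `GW(s, p)`. -/
def gwTree (N : List ℕ → ℕ) : SimpleGraph {v : List ℕ // Born N v} where
  Adj x y := (∃ i, y.1 = i :: x.1) ∨ (∃ i, x.1 = i :: y.1)
  symm := ⟨fun _ _ h => h.symm⟩
  loopless := ⟨fun x h => by
    rcases h with ⟨i, h⟩ | ⟨i, h⟩ <;> simpa using congrArg List.length h⟩

/-- The law of the set of open edges in Bernoulli bond percolation on `G`: each edge
is open with probability `θ`, independently of the others. -/
def bondPercolation {V : Type*} (G : SimpleGraph V) (θ : unitInterval) : Measure (Set (Sym2 V)) :=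
  setBernoulli G.edgeSet θ

/-- All connected components of the graph with edge set `E` are finite. -/
def NoGiantComponent {V : Type*} (E : Set (Sym2 V)) : Prop :=
  ∀ C : (SimpleGraph.fromEdgeSet E).ConnectedComponent, C.supp.Finite

/-- `q(K) = exp(4K) - 1`. -/
def q (K : ℝ) : ℝ := Real.exp (4 * K) - 1

/-- `K_c = (1/4) ln (a / (a - 1))`. -/
def Kc (p : DegreeLaw) : ℝ := 1 / 4 * Real.log (p.mean / (p.mean - 1))

/-- `K̂_c = (1/4) ln ((s^γ + 1) / s^γ)` with `γ = 1/α`. -/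
def KcHat (s : ℕ) (α : ℝ) : ℝ :=
  1 / 4 * Real.log (((s : ℝ) ^ (1 / α) + 1) / (s : ℝ) ^ (1 / α))

end GWPercolation

end

/-!
The condition on `θ` makes the process of open descendants subcritical for both kinds of
individuals, and this alone gives the result, by first moments.

* `q (Kc p) = 1 / (a - 1)`, where `a - 1` is the mean offspring number of an ordinary individual.
  The open descendants of an ordinary individual `n` generations later therefore number
  `(θ (a - 1)) ^ n` on average, which is summable. So almost every tree is such that, for each
  ordinary individual, the conditional expectation of the number of open descendants is finite
  (`ae_tsum_relBorn_ne_top`).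
* `q (KcHat s α) = s ^ (-1 / α) ≤ 1 / s`. In every tree, a distinguished individual has at most
  `s ^ n` distinguished descendants `n` generations later, of which at most `(θ s) ^ n` on average
  are openly connected to it, which is summable again (`tsum_words_below_ne_top`).

Given the tree, the Borel–Cantelli lemma (`ae_finite_openPath`) turns both bounds into almost sure
finiteness, simultaneously for the countably many labels. The open descendants of a distinguished
individual then consist of a finite distinguished part and of the finite clusters of the finitely
many ordinary children of that part (`finite_openPath`). Since every vertex of a component is an
open descendant of one of the finitely many ancestors of any given vertex in it, all
components are finite (`noGiantComponent_of_finite`).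
-/

namespace GWPercolation

/-! ### Sums over finite words -/

theorem tsum_prod_fin (f : ℕ → ℝ≥0∞) (n : ℕ) :
    ∑' v : Fin n → ℕ, ∏ j, f (v j) = (∑' i, f i) ^ n := by
  induction n with
  | zero => simp
  | succ n ih =>
    rw [← (Fin.consEquiv fun _ : Fin (n + 1) => ℕ).tsum_eq, ENNReal.tsum_prod', pow_succ', ← ih,
      ← ENNReal.tsum_mul_right]
    refine tsum_congr fun i => ?_
    rw [← ENNReal.tsum_mul_left]
    refine tsum_congr fun v => ?_
    simp [Fin.consEquiv, Fin.prod_univ_succ]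

/-- A multiplicative weight on words has finite total mass if the letters have mass less than one:
the words of length `n` have mass `(∑ f) ^ n`. -/
theorem tsum_list_prod_ne_top {f : ℕ → ℝ≥0∞} (hf : ∑' i, f i < 1) :
    ∑' x : List ℕ, (x.map f).prod ≠ ∞ := by
  rw [← List.equivSigmaTuple.symm.tsum_eq, ENNReal.tsum_sigma']
  have h (n : ℕ) : ∑' v : Fin n → ℕ, ((List.equivSigmaTuple.symm ⟨n, v⟩).map f).prod
      = (∑' i, f i) ^ n := by
    rw [← tsum_prod_fin]
    refine tsum_congr fun v => ?_
    simp [List.equivSigmaTuple, List.prod_ofFn]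
  simp_rw [h]
  exact (tsum_geometric_lt_top.2 hf).ne

/-! ### Parameters -/

/-- As `q (Kc p) = 1 / (a - 1)`, percolation on the ordinary offspring is subcritical. -/
theorem mul_mean_sub_one_lt_one {p : DegreeLaw} {θ : ℝ} (h : θ < q (Kc p)) :
    θ * (p.mean - 1) < 1 := by
  rcases p.one_le_mean.eq_or_lt with h1 | h1
  · -- Here `a = 1`, and the left side vanishes whatever the junk value of `Kc p` is.
    simp [← h1]
  · have h2 : 0 < p.mean - 1 := by linarith
    have h3 : q (Kc p) = 1 / (p.mean - 1) := by
      rw [q, Kc, ← mul_assoc, mul_one_div_cancel (by norm_num), one_mul,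
        Real.exp_log (div_pos (by linarith) h2)]
      field_simp
      ring
    rw [h3] at h
    exact (lt_div_iff₀ h2).1 h

/-- As `q (KcHat s α) = s ^ (-1 / α) ≤ 1 / s`, percolation on the distinguished offspring is
subcritical. -/
theorem mul_lt_one_of_lt_q_KcHat {s : ℕ} (hs : 2 ≤ s) {α : ℝ} (hα : α ∈ Set.Ioo (0 : ℝ) 1) {θ : ℝ}
    (h : θ < q (KcHat s α)) (h0 : 0 < θ) : θ * s < 1 := by
  have hs1 : (1 : ℝ) ≤ s := by exact_mod_cast (by omega : 1 ≤ s)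
  have hle : (s : ℝ) ≤ (s : ℝ) ^ (1 / α) := by
    conv_lhs => rw [← Real.rpow_one (s : ℝ)]
    exact Real.rpow_le_rpow_of_exponent_le hs1 (one_le_one_div hα.1 hα.2.le)
  have hpos : 0 < (s : ℝ) ^ (1 / α) := by linarith
  have h3 : q (KcHat s α) = 1 / (s : ℝ) ^ (1 / α) := by
    rw [q, KcHat, ← mul_assoc, mul_one_div_cancel (by norm_num), one_mul,
      Real.exp_log (by positivity), add_div, div_self hpos.ne', add_sub_cancel_left]
  rw [h3, lt_div_iff₀ hpos] at h
  exact (mul_le_mul_of_nonneg_left hle h0.le).trans_lt h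

/-- The tail sum formula for the mean offspring number `a - 1` of an ordinary individual. -/
theorem tsum_ordinaryLaw_tail (p : DegreeLaw) :
    ∑' i : ℕ, (ordinaryLaw p).toMeasure {m | i < m} = ENNReal.ofReal (p.mean - 1) := by
  have hsum : HasSum (fun m : ℕ => (m : ℝ) * p.mass (m + 1)) (p.mean - 1) := by
    have h := (p.summable_mean.hasSum.sub p.hasSum_mass)
    rw [← hasSum_nat_add_iff' 1] at h
    simp only [Finset.range_one, Finset.sum_singleton, p.mass_zero] at h
    have hlim : p.mean - 1 = ∑' k : ℕ, (k : ℝ) * p.mass k - 1 - (((0 : ℕ) : ℝ) * 0 - 0) := by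
      simp [DegreeLaw.mean]
    rw [hlim]
    refine h.congr_fun fun m => ?_
    push_cast
    ring
  calc ∑' i : ℕ, (ordinaryLaw p).toMeasure {m | i < m}
      = ∑' i : ℕ, ∑' m : ℕ, if i < m then ordinaryLaw p m else 0 := by
        refine tsum_congr fun i => ?_
        rw [PMF.toMeasure_apply _ MeasurableSet.of_discrete]
        simp [Set.indicator_apply]
    _ = ∑' m : ℕ, ∑' i : ℕ, if i < m then ordinaryLaw p m else 0 := ENNReal.tsum_comm
    _ = ∑' m : ℕ, ENNReal.ofReal ((m : ℝ) * p.mass (m + 1)) := by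
        refine tsum_congr fun m => ?_
        rw [tsum_eq_sum (s := Finset.range m) (by simp +contextual)]
        rw [Finset.sum_congr rfl fun i hi => if_pos (Finset.mem_range.1 hi)]
        rw [Finset.sum_const, Finset.card_range, nsmul_eq_mul, ENNReal.ofReal_mul (by positivity),
          ENNReal.ofReal_natCast]
        rfl
    _ = ENNReal.ofReal (p.mean - 1) := by
        rw [← ENNReal.ofReal_tsum_of_nonneg
          (fun m => mul_nonneg (Nat.cast_nonneg m) (p.mass_mem _).1) hsum.summable, hsum.tsum_eq]

/-! ### Kinds of descendants -/

theorem kind_append_of_ordinary {s : ℕ} {u : List ℕ} (h : kind s u = .ordinary) (x : List ℕ) :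
    kind s (x ++ u) = .ordinary := by
  induction x with
  | nil => exact h
  | cons i x ih => simp [kind, ih]

theorem kind_cons_of_le {s i : ℕ} (hi : s ≤ i) (v : List ℕ) : kind s (i :: v) = .ordinary := by
  cases h : kind s v <;> simp [kind, h, hi.not_gt]

theorem offspringLaw_of_ordinary {p : DegreeLaw} {s : ℕ} {r : RootRule} {u : List ℕ}
    (h : kind s u = .ordinary) : offspringLaw p s r u = ordinaryLaw p := by
  cases u with
  | nil => simp [kind] at h
  | cons i v => simp [offspringLaw, h]

/-! ### Descendants of an ordinary individual -/

/-- The descendant `x ++ u` of `u` is born, provided that `u` itself is. Unlike `Born`, this does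
not constrain the offspring numbers of the ancestors of `u`. -/
def RelBorn (N : List ℕ → ℕ) (u : List ℕ) : List ℕ → Prop
  | [] => True
  | i :: x => RelBorn N u x ∧ i < N (x ++ u)

/-- The event `RelBorn N u x` is a box: it bounds from below, separately, the offspring numbers of
`u` and of the individuals strictly between `u` and `x ++ u`. These individuals are distinct because
their labels have different lengths. -/
theorem exists_box_relBorn (ν : Measure ℕ) (u x : List ℕ) :
    ∃ (F : Finset (List ℕ)) (t : List ℕ → Set ℕ),
      {N | RelBorn N u x} = Set.pi F t ∧
      (∀ v ∈ F, v.length < x.length + u.length ∧ ∃ y, v = y ++ u) ∧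
      ∏ v ∈ F, ν (t v) = (x.map fun i => ν {m | i < m}).prod := by
  classical
  induction x with
  | nil => exact ⟨∅, fun _ => Set.univ, by simp [RelBorn]⟩
  | cons i x ih =>
    obtain ⟨F, t, h1, h2, h3⟩ := ih
    have hn : x ++ u ∉ F := fun h => by simpa using (h2 _ h).1
    have hne {v : List ℕ} (hv : v ∈ F) : v ≠ x ++ u := fun h => hn (h ▸ hv)
    refine ⟨insert (x ++ u) F, Function.update t (x ++ u) {m | i < m}, ?_, ?_, ?_⟩
    · have key (N : List ℕ → ℕ) : RelBorn N u x ↔ ∀ v ∈ F, N v ∈ t v := by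
        simpa using Set.ext_iff.1 h1 N
      ext N
      have h4 : (∀ v ∈ F, N v ∈ Function.update t (x ++ u) {m | i < m} v) ↔
          ∀ v ∈ F, N v ∈ t v :=
        forall₂_congr fun v hv => by rw [Function.update_of_ne (hne hv)]
      simp only [Set.mem_ofPred_eq, RelBorn, key, Set.mem_pi, Finset.mem_coe, Finset.mem_insert,
        forall_eq_or_imp, Function.update_self, h4, and_comm]
    · intro v hv
      rcases Finset.mem_insert.1 hv with rfl | hv
      · exact ⟨by simp, x, rfl⟩
      · refine ⟨(h2 v hv).1.trans (by simp), (h2 v hv).2⟩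
    · rw [Finset.prod_insert hn, Function.update_self, List.map_cons, List.prod_cons, ← h3]
      congr 1
      exact Finset.prod_congr rfl fun v hv => by rw [Function.update_of_ne (hne hv)]

theorem measurableSet_relBorn (u x : List ℕ) : MeasurableSet {N | RelBorn N u x} := by
  obtain ⟨F, t, h, -⟩ := exists_box_relBorn 0 u x
  rw [h]
  exact .pi F.countable_toSet fun _ _ => .of_discrete

theorem gwMeasure_relBorn (p : DegreeLaw) (s : ℕ) (r : RootRule) {u : List ℕ}
    (hu : kind s u = .ordinary) (x : List ℕ) :
    gwMeasure p s r {N | RelBorn N u x} =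
      (x.map fun i => (ordinaryLaw p).toMeasure {m | i < m}).prod := by
  obtain ⟨F, t, h1, h2, h3⟩ := exists_box_relBorn (ordinaryLaw p).toMeasure u x
  rw [h1, gwMeasure, Measure.infinitePi_pi _ fun _ _ => .of_discrete, ← h3]
  refine Finset.prod_congr rfl fun v hv => ?_
  obtain ⟨y, rfl⟩ := (h2 v hv).2
  rw [offspringLaw_of_ordinary (kind_append_of_ordinary hu y)]

/-- If edges are open with probability `t`, the sum bounds the expected number, given the tree, of
individuals reached by open paths that descend from `u`. Its mean over the tree is the geometric
series with ratio `t * (a - 1)`. -/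
theorem ae_tsum_relBorn_ne_top (p : DegreeLaw) (s : ℕ) (r : RootRule) {u : List ℕ}
    (hu : kind s u = .ordinary) {t : ℝ≥0∞} (ht : t * ENNReal.ofReal (p.mean - 1) < 1) :
    ∀ᵐ N ∂gwMeasure p s r,
      ∑' x : List ℕ, {x | RelBorn N u x}.indicator (fun x => t ^ x.length) x ≠ ∞ := by
  have hmeas (x : List ℕ) : Measurable fun N : List ℕ → ℕ =>
      {N | RelBorn N u x}.indicator (fun _ => t ^ x.length) N :=
    measurable_const.indicator (measurableSet_relBorn u x)
  have hswap (N : List ℕ → ℕ) :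
      ∑' x : List ℕ, {x | RelBorn N u x}.indicator (fun x => t ^ x.length) x =
        ∑' x : List ℕ, {N | RelBorn N u x}.indicator (fun _ => t ^ x.length) N := rfl
  simp_rw [hswap]
  refine (ae_lt_top (Measurable.tsum hmeas) ?_).mono fun N h => h.ne
  rw [lintegral_tsum fun x => (hmeas x).aemeasurable]
  have hx (x : List ℕ) :
      ∫⁻ N, {N | RelBorn N u x}.indicator (fun _ => t ^ x.length) N ∂gwMeasure p s r =
        (x.map fun i => t * (ordinaryLaw p).toMeasure {m | i < m}).prod := by
    rw [lintegral_indicator_const (measurableSet_relBorn u x), gwMeasure_relBorn p s r hu,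
      List.prod_map_mul]
    simp
  simp_rw [hx]
  apply tsum_list_prod_ne_top
  rwa [ENNReal.tsum_mul_left, tsum_ordinaryLaw_tail]

/-! ### Open paths -/

/-- The individual `i :: v` is born and the edge joining it to its parent `v` is open. -/
def OpenEdge (N : List ℕ → ℕ) (E : Set (Sym2 {v : List ℕ // Born N v})) (i : ℕ)
    (v : List ℕ) : Prop :=
  ∃ h : Born N (i :: v), s(⟨v, h.1⟩, ⟨i :: v, h⟩) ∈ E

/-- All edges on the path from `u` to its descendant `x ++ u` are open. -/
def OpenPath (N : List ℕ → ℕ) (E : Set (Sym2 {v : List ℕ // Born N v})) (u : List ℕ) :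
    List ℕ → Prop
  | [] => True
  | i :: x => OpenPath N E u x ∧ OpenEdge N E i (x ++ u)

section

variable {N : List ℕ → ℕ} {E : Set (Sym2 {v : List ℕ // Born N v})} {u : List ℕ}

theorem OpenPath.relBorn {x : List ℕ} (h : OpenPath N E u x) : RelBorn N u x := by
  induction x with
  | nil => trivial
  | cons i x ih => exact ⟨ih h.1, h.2.choose.2⟩

theorem OpenPath.born {x : List ℕ} (h : OpenPath N E u x) (hx : x ≠ []) : Born N (x ++ u) := by
  cases x with
  | nil => exact absurd rfl hx
  | cons i x => exact h.2.choose

/-- An open path either stays among the children numbered below `s`, or has a first step `i ≥ s`,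
after which it is an open path from `i :: (z ++ u)`. -/
theorem OpenPath.exists_split (s : ℕ) {x : List ℕ} (h : OpenPath N E u x) :
    (∀ i ∈ x, i < s) ∨ ∃ y i z, x = y ++ i :: z ∧ (∀ j ∈ z, j < s) ∧ s ≤ i ∧ OpenPath N E u z ∧
      i < N (z ++ u) ∧ OpenPath N E (i :: (z ++ u)) y := by
  induction x with
  | nil => simp
  | cons j x ih =>
    rcases ih h.1 with hx | ⟨y, i, z, rfl, hz, hi, hoz, hiN, hoy⟩
    · rcases lt_or_ge j s with hj | hj
      · exact .inl (by simpa [hj] using hx)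
      · exact .inr ⟨[], j, x, rfl, hx, hj, h.1, h.2.choose.2, trivial⟩
    · refine .inr ⟨j :: y, i, z, rfl, hz, hi, hoz, hiN, hoy, ?_⟩
      simpa using h.2

/-- Every vertex in the component of `v` is reached by an open path that descends from
an ancestor of `v`. -/
theorem exists_openPath_of_reachable (hE : E ⊆ (gwTree N).edgeSet)
    {v w : {v : List ℕ // Born N v}} (h : (SimpleGraph.fromEdgeSet E).Reachable v w) :
    ∃ u, u <:+ v.1 ∧ ∃ x, w.1 = x ++ u ∧ OpenPath N E u x := by
  rw [SimpleGraph.reachable_iff_reflTransGen] at h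
  induction h with
  | refl => exact ⟨v.1, List.suffix_rfl, [], rfl, trivial⟩
  | @tail b c _ hbc ih =>
    obtain ⟨u, hu, x, hx, ho⟩ := ih
    rw [SimpleGraph.fromEdgeSet_adj] at hbc
    have hadj : (gwTree N).Adj b c := hE hbc.1
    obtain ⟨b, hb⟩ := b
    obtain ⟨c, hc⟩ := c
    dsimp only at hx
    subst hx
    rcases hadj with ⟨i, hi⟩ | ⟨i, hi⟩
    · dsimp only at hi
      subst hi
      exact ⟨u, hu, i :: x, rfl, ho, hc, hbc.1⟩
    · dsimp only at hi
      cases x with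
      | nil =>
        -- The path leaves the subtree of `u`: its parent becomes the new starting point.
        rw [List.nil_append] at hi
        exact ⟨c, (hi ▸ List.suffix_cons i c).trans hu, [], rfl, trivial⟩
      | cons j x =>
        rw [List.cons_append, List.cons.injEq] at hi
        exact ⟨u, hu, x, hi.2.symm, ho.1⟩

/-- As an individual has finitely many ancestors, it suffices to bound the sets of openly connected
descendants. -/
theorem noGiantComponent_of_finite (hE : E ⊆ (gwTree N).edgeSet)
    (h : ∀ u, {x | OpenPath N E u x}.Finite) : NoGiantComponent E := by
  intro C
  induction C using SimpleGraph.ConnectedComponent.ind with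
  | h v =>
  have hfin : (⋃ u ∈ {u | u <:+ v.1}, (fun x => x ++ u) '' {x | OpenPath N E u x}).Finite := by
    refine Set.Finite.biUnion ?_ fun u _ => (h u).image _
    refine (v.1.tails.finite_toSet).subset fun u hu => ?_
    simpa using hu
  refine (hfin.preimage Subtype.val_injective.injOn).subset fun w hw => ?_
  have hr : (SimpleGraph.fromEdgeSet E).Reachable v w :=
    (SimpleGraph.ConnectedComponent.exact hw).symm
  obtain ⟨u, hu, x, hx, ho⟩ := exists_openPath_of_reachable hE hr
  simp only [Set.mem_preimage, Set.mem_iUnion]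
  exact ⟨u, hu, x, ho, hx.symm⟩

/-- An infinite number of openly connected descendants cannot arise by attaching, to finitely many
individuals with finitely many children each, the finite clusters of their ordinary children.
For distinguished `u`, the words with letters below `s` label its distinguished descendants;
no assumption on the kind of `u` is needed, since children numbered from `s` on are always
ordinary. -/
theorem finite_openPath (s : ℕ)
    (hd : ∀ u, {x | (∀ i ∈ x, i < s) ∧ OpenPath N E u x}.Finite)
    (ho : ∀ u, kind s u = .ordinary → {x | OpenPath N E u x}.Finite) (u : List ℕ) :
    {x | OpenPath N E u x}.Finite := by
  have hfin : (⋃ z ∈ {x | (∀ i ∈ x, i < s) ∧ OpenPath N E u x},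
      ⋃ i ∈ Set.Ico s (N (z ++ u)),
        (fun y => y ++ i :: z) '' {y | OpenPath N E (i :: (z ++ u)) y}).Finite :=
    (hd u).biUnion fun z _ => (Set.finite_Ico _ _).biUnion fun i hi =>
      (ho _ (kind_cons_of_le hi.1 _)).image _
  refine ((hd u).union hfin).subset fun x hx => ?_
  rcases hx.exists_split s with h | ⟨y, i, z, rfl, hz, hi, hoz, hiN, hoy⟩
  · exact .inl ⟨h, hx⟩
  · right
    simp only [Set.mem_iUnion]
    exact ⟨z, ⟨hz, hoz⟩, i, ⟨hi, hiN⟩, y, hoy, rfl⟩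

end

/-! ### Percolation on a fixed tree -/

/-- Only an inequality, since `F` may contain elements outside `A`, which are never selected. -/
theorem setBernoulli_superset_le {ι : Type*} (A : Set ι) (θ : unitInterval) (F : Finset ι) :
    setBernoulli A θ {E | ↑F ⊆ E} ≤ ENNReal.ofReal θ ^ F.card := by
  rw [setBernoulli_apply']
  have h : (fun P : ι → Prop => {i | P i}) ⁻¹' {E | ↑F ⊆ E} = Set.pi F fun _ => {True} := by
    ext P
    simp [Set.subset_def]
  rw [h, Measure.infinitePi_pi _ fun _ _ => .of_discrete]
  refine Finset.prod_le_pow_card _ _ _ fun i _ => ?_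
  have hθ : (unitInterval.toNNReal θ : ℝ≥0∞) = ENNReal.ofReal θ := by
    rw [ENNReal.ofReal, Real.toNNReal_of_nonneg θ.2.1]
    rfl
  rw [Measure.add_apply, Measure.smul_apply, Measure.smul_apply,
    Measure.dirac_apply' _ .of_discrete, Measure.dirac_apply' _ .of_discrete]
  rw [← hθ]
  by_cases hi : i ∈ A <;> simp [hi]

/-- The path from `u` to `x ++ u` has `x.length` distinct edges. The bound on the lengths of their
endpoints is what carries the induction: it shows that the last edge is new. -/
theorem exists_finset_edges {N : List ℕ → ℕ} (u x : List ℕ) (hb : Born N (x ++ u)) :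
    ∃ F : Finset (Sym2 {v : List ℕ // Born N v}), F.card = x.length ∧
      (∀ e ∈ F, ∀ v ∈ e, v.1.length ≤ x.length + u.length) ∧
      ∀ E, OpenPath N E u x → ↑F ⊆ E := by
  classical
  induction x with
  | nil => exact ⟨∅, by simp⟩
  | cons i x ih =>
    obtain ⟨F, h1, h2, h3⟩ := ih hb.1
    have hn : s(⟨x ++ u, hb.1⟩, ⟨i :: (x ++ u), hb⟩) ∉ F := fun h => by
      simpa using h2 _ h ⟨i :: (x ++ u), hb⟩ (Sym2.mem_mk_right _ _)
    refine ⟨insert s(⟨x ++ u, hb.1⟩, ⟨i :: (x ++ u), hb⟩) F, ?_, ?_, ?_⟩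
    · rw [Finset.card_insert_of_notMem hn, h1, List.length_cons]
    · intro e he v hv
      rcases Finset.mem_insert.1 he with rfl | he
      · rcases Sym2.mem_iff.1 hv with rfl | rfl <;> simp
      · exact (h2 e he v hv).trans (by simp)
    · intro E hE
      rw [Finset.coe_insert, Set.insert_subset_iff]
      exact ⟨hE.2.choose_spec, h3 E hE.1⟩

theorem bondPercolation_openPath_le (N : List ℕ → ℕ) (θ : unitInterval) (u x : List ℕ) :
    bondPercolation (gwTree N) θ {E | OpenPath N E u x} ≤ ENNReal.ofReal θ ^ x.length := by
  by_cases hb : Born N (x ++ u)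
  · obtain ⟨F, h1, -, h3⟩ := exists_finset_edges u x hb
    exact (measure_mono h3).trans (h1 ▸ setBernoulli_superset_le _ θ F)
  · rcases eq_or_ne x [] with rfl | hx
    · simpa [bondPercolation] using prob_le_one
    · have h : {E | OpenPath N E u x} = ∅ :=
        Set.eq_empty_of_forall_notMem fun E hE => hb (hE.born hx)
      simp [h]

/-- The Borel–Cantelli lemma, for open paths on a fixed tree. -/
theorem ae_finite_openPath (N : List ℕ → ℕ) (θ : unitInterval) (u : List ℕ) (S : Set (List ℕ))
    (h : ∑' x, S.indicator (fun x => ENNReal.ofReal θ ^ x.length) x ≠ ∞) :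
    ∀ᵐ E ∂bondPercolation (gwTree N) θ, {x | x ∈ S ∧ OpenPath N E u x}.Finite := by
  refine ae_finite_setOfPred_mem (s := fun x => {E | x ∈ S ∧ OpenPath N E u x})
    (ne_top_of_le_ne_top h (ENNReal.tsum_le_tsum fun x => ?_))
  by_cases hx : x ∈ S
  · simpa [hx] using bondPercolation_openPath_le N θ u x
  · simp [hx]

/-- The words with letters below `s` label the possible distinguished descendants of a
distinguished individual: at most `s ^ n` after `n` generations, whatever the tree is. -/
theorem tsum_words_below_ne_top {s : ℕ} {t : ℝ≥0∞} (h : t * s < 1) :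
    ∑' x : List ℕ, {x : List ℕ | ∀ i ∈ x, i < s}.indicator (fun x => t ^ x.length) x ≠ ∞ := by
  have hx (x : List ℕ) : {x : List ℕ | ∀ i ∈ x, i < s}.indicator (fun x => t ^ x.length) x =
      (x.map fun i => if i < s then t else 0).prod := by
    induction x with
    | nil => simp
    | cons i x ih =>
      rw [List.map_cons, List.prod_cons, ← ih]
      by_cases hi : i < s <;> by_cases hxs : ∀ j ∈ x, j < s <;>
        simp [Set.indicator, hi, hxs, pow_succ']
  simp_rw [hx]
  apply tsum_list_prod_ne_top
  rw [tsum_eq_sum (s := Finset.range s) (by simp +contextual),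
    Finset.sum_congr rfl fun i hi => if_pos (Finset.mem_range.1 hi)]
  simpa [mul_comm] using h

end GWPercolation

theorem proposition1 (p : GWPercolation.DegreeLaw) (r : GWPercolation.RootRule)
    (s : ℕ) (hs : 2 ≤ s) (α : ℝ) (hα : α ∈ Set.Ioo (0 : ℝ) 1) (hb : p.bAlpha s α < ⊤)
    (θ : unitInterval) (hθ : (θ : ℝ) ∈ Set.Ioo (0 : ℝ) 1)
    (hlt : (θ : ℝ) <
      min (GWPercolation.q (GWPercolation.Kc p)) (GWPercolation.q (GWPercolation.KcHat s α))) :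
    ∀ᵐ N ∂(GWPercolation.gwMeasure p s r),
      ∀ᵐ E ∂(GWPercolation.bondPercolation (GWPercolation.gwTree N) θ),
        GWPercolation.NoGiantComponent E := by
  open GWPercolation in
  have h1 : ENNReal.ofReal θ * ENNReal.ofReal (p.mean - 1) < 1 := by
    rw [← ENNReal.ofReal_mul hθ.1.le, ENNReal.ofReal_lt_one]
    exact mul_mean_sub_one_lt_one (hlt.trans_le (min_le_left _ _))
  have h2 : ENNReal.ofReal θ * s < 1 := by
    rw [← ENNReal.ofReal_natCast, ← ENNReal.ofReal_mul hθ.1.le, ENNReal.ofReal_lt_one]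
    exact mul_lt_one_of_lt_q_KcHat hs hα (hlt.trans_le (min_le_right _ _)) hθ.1
  have hN : ∀ᵐ N ∂gwMeasure p s r, ∀ u, kind s u = .ordinary →
      ∑' x : List ℕ, {x | RelBorn N u x}.indicator
        (fun x => ENNReal.ofReal θ ^ x.length) x ≠ ∞ :=
    ae_all_iff.2 fun u => Filter.eventually_imp_distrib_left.2 fun hu =>
      ae_tsum_relBorn_ne_top p s r hu h1
  filter_upwards [hN] with N hN
  have hd : ∀ᵐ E ∂bondPercolation (gwTree N) θ, ∀ u,
      {x | (∀ i ∈ x, i < s) ∧ OpenPath N E u x}.Finite :=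
    ae_all_iff.2 fun u => ae_finite_openPath N θ u _ (tsum_words_below_ne_top h2)
  have ho : ∀ᵐ E ∂bondPercolation (gwTree N) θ, ∀ u, kind s u = .ordinary →
      {x | OpenPath N E u x}.Finite := by
    refine ae_all_iff.2 fun u => Filter.eventually_imp_distrib_left.2 fun hu => ?_
    filter_upwards [ae_finite_openPath N θ u _ (hN u hu)] with E hE
    exact hE.subset fun x hx => ⟨hx.relBorn, hx⟩
  have hsub : ∀ᵐ E ∂bondPercolation (gwTree N) θ, E ⊆ (gwTree N).edgeSet :=
    setBernoulli_ae_subset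
  filter_upwards [hd, ho, hsub] with E hd ho hE
  exact noGiantComponent_of_finite hE (finite_openPath s hd ho)
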